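/- Let $0<\alpha\le 2$, let $\mathbb H$ be a real separable Hilbert space with norm $\|\cdot\|$ and scalar product $(\cdot,\cdot)$, and let $T$ be a positive trace-class operator on $\mathbb H$ with infinitely many positive eigenvalues, listed in decreasing order and counted with multiplicity as $\lambda_1\ge\lambda_2\ge\dots>0$. Let $\nu$ be the symmetric $\alpha$-stable probability measure on $\mathbb H$ with characteristic function $$\widehat\nu(y)=\exp\Bigl(-\tfrac12 (Ty,y)^{\alpha/2}\Bigr),\qquad y\in\mathbb H ,$$ and put $S_\varepsilon=\{x\in\mathbb H:\|x\|\le\varepsilon\}$. Let $\bar\sigma:[1,\infty)\to(0,\infty)$ be a differentiable decreasing function such that $\bar\sigma(j)\le\lambda_j^{1/2}$ for all integers $j\ge 1$. For $x,y\ge 1$ put $$\kappa(x)=\Bigl(\frac{2}{\alpha}\Bigr)^{1/\alpha}\frac{x^{(1-\alpha)/\alpha}}{\bar\sigma(x)},\qquad L(y)=\int_1^y\frac{x\,\kappa'(x)}{\kappa(x)}\,dx ,$$ and let $\zeta$ be any function with values in the positive integers such that $\varepsilon\,\kappa(\zeta(\varepsilon))\le 1$ for all $0<\varepsilon<\kappa(1)^{-1}$.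 Then there is a constant $C=C(\alpha,\lambda_1)$, depending only on $\alpha$ and $\lambda_1$, such that for all $0<\varepsilon<\kappa(1)^{-1}$ $$\nu(S_\varepsilon)\le C\exp\Bigl(-L(\zeta(\varepsilon))-\frac{2-\alpha}{2\alpha}\log\zeta(\varepsilon)-\log\varepsilon\Bigr),$$ and, if moreover $\log\bar\sigma$ is convex on $[1,\infty)$, such that for all $0<\varepsilon<\kappa(1)^{-1}$ $$\nu(S_\varepsilon)\le C\exp\Bigl(-L(\zeta(\varepsilon))-\frac{1}{2\alpha}\log\bigl(\varepsilon^{\alpha}\zeta(\varepsilon)\bigr)\Bigr).$$ -/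

import Mathlib

open MeasureTheory Set

open scoped InnerProductSpace

universe u

noncomputable section

namespace SmallBall

variable {H : Type u} [NormedAddCommGroup H] [InnerProductSpace ℝ H]

/-- A positive (self-adjoint, nonnegative) bounded operator on a real Hilbert space is of trace
class if the sum of the (nonnegative) numbers `⟪T b, b⟫` over the members `b` of some orthonormal
basis is finite. (For positive operators the sum does not depend on the orthonormal basis.) -/
def IsPositiveTraceClass [CompleteSpace H] (T : H →L[ℝ] H) : Prop :=
  T.IsPositive ∧
    ∃ (s : Set H) (b : HilbertBasis s ℝ H), Summable fun i : s => ⟪T (b i), b i⟫_ℝ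

/-- `lam 0 ≥ lam 1 ≥ ⋯ > 0` is the infinite list of the positive eigenvalues of `T` in decreasing
order, each repeated according to its (finite) multiplicity. The index is shifted by one:
`lam j` is the eigenvalue usually written `λ_{j+1}`. -/
structure IsEigenvalueSequence (T : H →L[ℝ] H) (lam : ℕ → ℝ) : Prop where
  antitone : Antitone lam
  pos : ∀ j, 0 < lam j
  finite : ∀ t : ℝ, 0 < t → {j : ℕ | lam j = t}.Finite
  multiplicity : ∀ t : ℝ, 0 < t →
    Module.finrank ℝ (Module.End.eigenspace (T : H →ₗ[ℝ] H) t) = {j : ℕ | lam j = t}.ncard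

/-- `ν` is the symmetric `α`-stable law on `H` with characteristic function
`y ↦ exp (-(1/2) * ⟪T y, y⟫ ^ (α / 2))`. -/
structure IsStableLaw [MeasurableSpace H] (ν : Measure H) (α : ℝ) (T : H →L[ℝ] H) : Prop where
  isProbabilityMeasure : IsProbabilityMeasure ν
  charFun_eq : ∀ y : H,
    charFun ν y = ((Real.exp (-(1 / 2) * ⟪T y, y⟫_ℝ ^ (α / 2)) : ℝ) : ℂ)

/-- `κ(x) = (2/α)^{1/α} x^{(1-α)/α} / σ(x)`. -/
def kappa (α : ℝ) (σ : ℝ → ℝ) (x : ℝ) : ℝ :=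
  (2 / α) ^ (1 / α) * x ^ ((1 - α) / α) * (σ x)⁻¹

/-- `L(y) = ∫_1^y x κ'(x) / κ(x) dx`. -/
def ell (α : ℝ) (σ : ℝ → ℝ) (y : ℝ) : ℝ :=
  ∫ x in (1 : ℝ)..y, x * deriv (kappa α σ) x / kappa α σ x

end SmallBall

end

/-!
The proof compares the ball of `H` with a ball in dimension `N = ζ(ε)`.

Orthogonal projection onto the span of `N` orthonormal eigenvectors for `λ_1, …, λ_N` shrinks
norms, and the projected law has characteristic function `exp(-½ (∑ λ_j y_j²)^{α/2})`. This is
integrable, so the projected law has a density bounded by `(2π)^{-N}` times the integral of that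
function (`measureReal_closedBall_le_charFun`, by Fourier inversion of smooth bump functions).
A linear change of variables evaluates the integral and gives, with `V_N` the volume of the
Euclidean unit ball (`IsStableLaw.measureReal_closedBall_le`),
`ν(S_ε) ≤ ε^N ∏ λ_j^{-1/2} · (2π)^{-N} V_N² 2^{N/α} Γ(N/α + 1)`.

Here `V_N² = π^N / Γ(N/2 + 1)²`. The duplication formula bounds `Γ(N/2 + 1)²` below by
`2^{-N} N! √(πN/2)`, so Stirling's formula bounds the logarithm of the dimensional factor by
`(N/α) log(2/α) + (1/α - 1)(N log N - N) - ½ log N + O(1)` (`dimensional_constant_le`).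

On the other side, integration by parts gives
`L(N) = (1/α - 1)(N - 1) - N log σ(N) + log σ(1) + ∫_1^N log σ` (`ell_eq`).
What remains is to bound `∫_1^N log σ` by `∑_{j ≤ N} log σ(j)` minus a boundary term, which is
`log σ(N)` if only monotonicity is known and `½ (log σ(1) + log σ(N))` if `log σ` is convex.
The multiples of `log κ(N) + log ε ≤ 0` that appear, `N + 1` and `N + ½`, are discarded; they
account for the terms `-log ε` and `-½ log ε` in the two exponents.
-/

namespace SmallBall

open scoped FourierTransform ContDiff
open Module (finrank)

/-! ### Balls under a law with integrable characteristic function -/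

section Density

variable {V : Type*} [NormedAddCommGroup V] [InnerProductSpace ℝ V] [FiniteDimensional ℝ V]
  [MeasurableSpace V] [BorelSpace V]

/-- Fourier inversion paired with a probability measure: the integral of a Schwartz function is
bounded by its `L¹` norm times the `L¹` norm of the characteristic function. -/
lemma norm_integral_schwartz_le (μ : Measure V) [IsProbabilityMeasure μ]
    (hμ : Integrable (charFun μ)) (f : SchwartzMap V ℂ) :
    ‖∫ x, f x ∂μ‖ ≤ (∫ x, ‖f x‖) *
      (((2 * Real.pi) ^ finrank ℝ V)⁻¹ * ∫ y, ‖charFun μ y‖) := by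
  set g : SchwartzMap V ℂ := 𝓕⁻ f with hg
  have hflip := VectorFourier.integral_fourierIntegral_smul_eq_flip (e := 𝐞)
    (μ := (volume : Measure V)) (ν := μ) (L := innerₗ V) (f := g) (g := fun _ => (1 : ℂ))
    Real.continuous_fourierChar (by simpa using continuous_inner) g.integrable
    (integrable_const _)
  have hfg : ∀ x, VectorFourier.fourierIntegral 𝐞 volume (innerₗ V) g x = f x := by
    intro x
    have : (𝓕 g : SchwartzMap V ℂ) = f := by simp [hg]
    rw [← this, SchwartzMap.fourier_coe]
    rfl
  have hchar : ∀ y, VectorFourier.fourierIntegral 𝐞 μ (innerₗ V).flip (fun _ => (1 : ℂ)) y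
      = charFun μ ((-(2 * Real.pi)) • y) := by
    intro y
    have hfl : (innerₗ V).flip = innerₗ V := by
      ext x y; exact real_inner_comm _ _
    rw [charFun_eq_fourierIntegral', hfl, smul_smul]
    have : -(2 * Real.pi)⁻¹ * -(2 * Real.pi) = 1 := by
      have := Real.pi_pos; field_simp
    rw [this, one_smul]
    rfl
  simp only [hfg, hchar, smul_eq_mul, mul_one] at hflip
  have hint : Integrable (fun y => ‖charFun μ ((-(2 * Real.pi)) • y)‖) :=
    (hμ.comp_smul (by have := Real.pi_pos; simp)).norm
  have hgb : ∀ y, ‖g y‖ ≤ ∫ x, ‖f x‖ := by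
    intro y
    rw [hg, SchwartzMap.fourierInv_coe, Real.fourierInv_eq_fourier_neg]
    exact VectorFourier.norm_fourierIntegral_le_integral_norm _ _ _ _ _
  rw [hflip]
  refine (norm_integral_le_of_norm_le (hint.const_mul (∫ x, ‖f x‖))
    (Filter.Eventually.of_forall fun y => ?_)).trans ?_
  · rw [norm_mul]
    gcongr
    exact hgb y
  · rw [integral_const_mul, Measure.integral_comp_smul volume (fun y => ‖charFun μ y‖)]
    rw [abs_inv, abs_pow, abs_neg, abs_of_pos (by positivity : 0 < 2 * Real.pi), smul_eq_mul]

/-- A law with integrable characteristic function has a density bounded by the `L¹` norm of that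
function, up to the Fourier normalisation. This is the resulting estimate for balls. -/
lemma measureReal_closedBall_le_charFun (μ : Measure V) [IsProbabilityMeasure μ]
    (hμ : Integrable (charFun μ)) {r : ℝ} (hr : 0 < r) :
    μ.real (Metric.closedBall 0 r) ≤ r ^ finrank ℝ V * volume.real (Metric.ball (0 : V) 1) *
      (((2 * Real.pi) ^ finrank ℝ V)⁻¹ * ∫ y, ‖charFun μ y‖) := by
  set K := ((2 * Real.pi) ^ finrank ℝ V)⁻¹ * ∫ y, ‖charFun μ y‖ with hK
  have hK0 : 0 ≤ K := by positivity
  have key : ∀ R, r < R → μ.real (Metric.closedBall 0 r) ≤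
      R ^ finrank ℝ V * volume.real (Metric.ball (0 : V) 1) * K := by
    intro R hR
    let b : ContDiffBump (0 : V) := ⟨r, R, hr, hR⟩
    have hcs : HasCompactSupport (fun x => (b x : ℂ)) :=
      b.hasCompactSupport.comp_left (g := fun t : ℝ => (t : ℂ)) (by simp)
    have hsm : ContDiff ℝ ∞ (fun x => (b x : ℂ)) :=
      Complex.ofRealCLM.contDiff.comp b.contDiff
    let f : SchwartzMap V ℂ := hcs.toSchwartzMap hsm
    have hf : ∀ x, f x = (b x : ℂ) := fun x => rfl
    have hbint : Integrable (fun x => b x) μ := by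
      refine Integrable.mono' (integrable_const (1 : ℝ)) b.continuous.aestronglyMeasurable ?_
      exact Filter.Eventually.of_forall fun x => by
        rw [Real.norm_of_nonneg b.nonneg]; exact b.le_one
    have h1 : μ.real (Metric.closedBall 0 r) ≤ ∫ x, b x ∂μ := by
      rw [← integral_indicator_one Metric.isClosed_closedBall.measurableSet]
      refine integral_mono ((integrable_const (1 : ℝ)).indicator
        Metric.isClosed_closedBall.measurableSet) hbint fun x => ?_
      by_cases hx : x ∈ Metric.closedBall (0 : V) r
      · simp [hx, b.one_of_mem_closedBall hx]
      · simp [hx, b.nonneg]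
    have h2 : ∫ x, b x ∂μ ≤ ‖∫ x, f x ∂μ‖ := by
      simp only [hf]
      rw [integral_complex_ofReal]
      simp [le_abs_self]
    have h3 : ∫ x, ‖f x‖ ≤ R ^ finrank ℝ V * volume.real (Metric.ball (0 : V) 1) := by
      have h4 : ∫ x, ‖f x‖ ≤ ∫ x : V, (Metric.closedBall (0 : V) R).indicator 1 x := by
        refine integral_mono f.integrable.norm ((integrable_indicator_iff
          Metric.isClosed_closedBall.measurableSet).2 ?_) fun x => ?_
        · exact integrableOn_const (C := (1 : ℝ)) measure_closedBall_lt_top.ne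
        · simp only [hf, Complex.norm_real, Real.norm_of_nonneg b.nonneg]
          by_cases hx : x ∈ Metric.closedBall (0 : V) R
          · simp [hx, b.le_one]
          · have : x ∉ Function.support b := by
              rw [b.support_eq]
              exact fun h => hx (Metric.ball_subset_closedBall h)
            simp [hx, Function.notMem_support.1 this]
      refine h4.trans ?_
      rw [integral_indicator_one Metric.isClosed_closedBall.measurableSet]
      rw [measureReal_def, Measure.addHaar_closedBall _ _ (hr.trans hR).le, ENNReal.toReal_mul,
        ENNReal.toReal_ofReal (by have := hr.trans hR; positivity)]
      rfl
    calc _ ≤ _ := h1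
      _ ≤ _ := h2
      _ ≤ _ := norm_integral_schwartz_le μ hμ f
      _ ≤ _ := by gcongr
  -- let the outer radius `R` of the bump function decrease to `r`
  have hcont : Continuous fun R : ℝ =>
      R ^ finrank ℝ V * volume.real (Metric.ball (0 : V) 1) * K := by fun_prop
  exact ge_of_tendsto (hcont.continuousWithinAt (s := Ioi r) (x := r))
    (Filter.eventually_of_mem self_mem_nhdsWithin key)

end Density

/-! ### Stable laws on Euclidean space -/

section FiniteDimensional

/-- The value is Mathlib's formula for the volume of the unit ball, read backwards. It is nonzero,
which gives integrability. -/
lemma integrable_exp_neg_norm_rpow_and_integral {N : ℕ} (hN : 0 < N) {p : ℝ} (hp : 0 < p) :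
    Integrable (fun x : EuclideanSpace ℝ (Fin N) => Real.exp (-‖x‖ ^ p)) ∧
    ∫ x : EuclideanSpace ℝ (Fin N), Real.exp (-‖x‖ ^ p) =
      volume.real (Metric.ball (0 : EuclideanSpace ℝ (Fin N)) 1) * Real.Gamma (N / p + 1) := by
  have hG : 0 < Real.Gamma (N / p + 1) := Real.Gamma_pos_of_pos (by positivity)
  have h := measure_unitBall_eq_integral_div_gamma
    (volume : Measure (EuclideanSpace ℝ (Fin N))) hp
  rw [finrank_euclideanSpace_fin] at h
  have hI : 0 ≤ ∫ x : EuclideanSpace ℝ (Fin N), Real.exp (-‖x‖ ^ p) := by positivity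
  have h' : ∫ x : EuclideanSpace ℝ (Fin N), Real.exp (-‖x‖ ^ p) =
      volume.real (Metric.ball (0 : EuclideanSpace ℝ (Fin N)) 1) * Real.Gamma (N / p + 1) := by
    rw [measureReal_def, h, ENNReal.toReal_ofReal (by positivity), div_mul_cancel₀ _ hG.ne']
  refine ⟨Integrable.of_integral_ne_zero ?_, h'⟩
  rw [h']
  have : 0 < volume.real (Metric.ball (0 : EuclideanSpace ℝ (Fin N)) 1) :=
    ENNReal.toReal_pos (Metric.measure_ball_pos _ _ one_pos).ne' measure_ball_lt_top.ne
  positivity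

/-- The diagonal operator with entries `d` on Euclidean space. -/
noncomputable def diagonalMap {N : ℕ} (d : Fin N → ℝ) :
    EuclideanSpace ℝ (Fin N) →ₗ[ℝ] EuclideanSpace ℝ (Fin N) :=
  Matrix.toLin (EuclideanSpace.basisFun (Fin N) ℝ).toBasis
    (EuclideanSpace.basisFun (Fin N) ℝ).toBasis (Matrix.diagonal d)

lemma diagonalMap_apply {N : ℕ} (d : Fin N → ℝ) (y : EuclideanSpace ℝ (Fin N)) (j : Fin N) :
    diagonalMap d y j = d j * y j := by
  have := congrFun (LinearMap.toMatrix_mulVec_repr (EuclideanSpace.basisFun (Fin N) ℝ).toBasis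
    (EuclideanSpace.basisFun (Fin N) ℝ).toBasis (diagonalMap d) y) j
  simp [diagonalMap, Matrix.mulVec_diagonal] at this
  rw [diagonalMap, ← this]

lemma det_diagonalMap {N : ℕ} (d : Fin N → ℝ) : LinearMap.det (diagonalMap d) = ∏ j, d j := by
  rw [diagonalMap, LinearMap.det_toLin, Matrix.det_diagonal]

/-- The bound for the mass of a ball under a symmetric stable law on `ℝ^N` with diagonal
covariance operator, in terms of the volume of the unit ball and a value of the Gamma function. -/
lemma measureReal_closedBall_le_of_stable {N : ℕ} (hN : 0 < N) {α : ℝ} (hα : 0 < α)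
    (a : Fin N → ℝ) (ha : ∀ j, 0 < a j) (μ : Measure (EuclideanSpace ℝ (Fin N)))
    [IsProbabilityMeasure μ]
    (hμ : ∀ y, charFun μ y =
      ((Real.exp (-(1 / 2) * (∑ j, a j * y j ^ 2) ^ (α / 2)) : ℝ) : ℂ))
    {r : ℝ} (hr : 0 < r) :
    μ.real (Metric.closedBall 0 r) ≤ r ^ N * (∏ j, √(a j))⁻¹ *
      (((2 * Real.pi) ^ N)⁻¹ * volume.real (Metric.ball (0 : EuclideanSpace ℝ (Fin N)) 1) ^ 2 *
        (2 : ℝ) ^ (N / α) * Real.Gamma (N / α + 1)) := by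
  -- with `D = diag (2^{-1/α} √a_j)` the characteristic function is `exp (-‖D y‖ ^ α)`
  set c : ℝ := (2 : ℝ) ^ (-(1 / α)) with hc
  have hc0 : 0 < c := by positivity
  set D := diagonalMap (fun j => c * √(a j)) with hD
  have hDdet : LinearMap.det D = c ^ N * ∏ j, √(a j) := by
    rw [hD, det_diagonalMap, Finset.prod_mul_distrib]; simp
  have hprod : 0 < ∏ j, √(a j) := Finset.prod_pos fun j _ => Real.sqrt_pos.2 (ha j)
  have hdet0 : 0 < LinearMap.det D := by rw [hDdet]; positivity
  have hchar : ∀ y, charFun μ y = ((Real.exp (-‖D y‖ ^ α) : ℝ) : ℂ) := by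
    intro y
    rw [hμ]
    congr 2
    have hs : 0 ≤ ∑ j, a j * y j ^ 2 :=
      Finset.sum_nonneg fun j _ => mul_nonneg (ha j).le (sq_nonneg _)
    have hn : ‖D y‖ = c * √(∑ j, a j * y j ^ 2) := by
      rw [EuclideanSpace.norm_eq]
      have : ∑ i, ‖D y i‖ ^ 2 = c ^ 2 * ∑ j, a j * y j ^ 2 := by
        rw [Finset.mul_sum]
        refine Finset.sum_congr rfl fun j _ => ?_
        rw [hD, diagonalMap_apply, Real.norm_eq_abs, sq_abs, mul_pow, mul_pow,
          Real.sq_sqrt (ha j).le]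
        ring
      rw [this, Real.sqrt_mul (by positivity), Real.sqrt_sq hc0.le]
    rw [hn, Real.mul_rpow hc0.le (Real.sqrt_nonneg _), hc, ← Real.rpow_mul (by norm_num),
      Real.sqrt_eq_rpow, ← Real.rpow_mul hs]
    have e1 : -(1 / α) * α = -1 := by field_simp
    have e2 : 1 / 2 * α = α / 2 := by ring
    rw [e1, e2, Real.rpow_neg_one]
    ring
  have hmap := Measure.map_linearMap_addHaar_eq_smul_addHaar
    (volume : Measure (EuclideanSpace ℝ (Fin N))) hdet0.ne'
  obtain ⟨hint, hval⟩ := integrable_exp_neg_norm_rpow_and_integral hN hα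
  have hDm : Measurable D := (LinearMap.continuous_of_finiteDimensional D).measurable
  have hint' : Integrable (fun y => Real.exp (-‖D y‖ ^ α)) := by
    have : Integrable (fun x : EuclideanSpace ℝ (Fin N) => Real.exp (-‖x‖ ^ α))
        (Measure.map D volume) := by
      rw [hmap]; exact hint.smul_measure ENNReal.ofReal_ne_top
    exact this.comp_measurable hDm
  have hval' : ∫ y, Real.exp (-‖D y‖ ^ α) = (c ^ N * ∏ j, √(a j))⁻¹ *
      (volume.real (Metric.ball (0 : EuclideanSpace ℝ (Fin N)) 1) * Real.Gamma (N / α + 1)) := by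
    have h1 := integral_map (μ := (volume : Measure (EuclideanSpace ℝ (Fin N))))
      hDm.aemeasurable
      (f := fun x : EuclideanSpace ℝ (Fin N) => Real.exp (-‖x‖ ^ α))
      (by rw [hmap]; exact (hint.smul_measure ENNReal.ofReal_ne_top).aestronglyMeasurable)
    rw [← h1, hmap, integral_smul_measure, hval, ENNReal.toReal_ofReal (abs_nonneg _),
      abs_of_pos (inv_pos.2 hdet0), hDdet, smul_eq_mul]
  have hci : Integrable (charFun μ) := by
    rw [funext hchar]; exact hint'.ofReal
  have hb := measureReal_closedBall_le_charFun μ hci hr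
  have hnorm : ∀ y, ‖charFun μ y‖ = Real.exp (-‖D y‖ ^ α) := by
    intro y
    rw [hchar, Complex.norm_real, Real.norm_of_nonneg (Real.exp_pos _).le]
  simp only [hnorm] at hb
  rw [hval', finrank_euclideanSpace_fin] at hb
  refine hb.trans_eq ?_
  have hcN : (c ^ N)⁻¹ = (2 : ℝ) ^ (N / α) := by
    rw [hc, ← Real.rpow_natCast, ← Real.rpow_mul (by norm_num), ← Real.rpow_neg (by norm_num)]
    congr 1
    ring
  rw [mul_inv, hcN]
  ring

end FiniteDimensional

/-! ### Projection onto eigenvectors -/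

section Projection

variable {H : Type u} [NormedAddCommGroup H] [InnerProductSpace ℝ H]

/-- The eigenvalue sequence is realised by orthonormal eigenvectors: an orthonormal basis of each
eigenspace is labelled by the indices at which its eigenvalue occurs. -/
lemma IsEigenvalueSequence.exists_orthonormal [CompleteSpace H] {T : H →L[ℝ] H} {lam : ℕ → ℝ}
    (hT : T.IsPositive) (h : IsEigenvalueSequence T lam) :
    ∃ e : ℕ → H, Orthonormal ℝ e ∧ ∀ j, T (e j) = lam j • e j := by
  have hsymm : (T : H →ₗ[ℝ] H).IsSymmetric := hT.isSymmetric
  have hlocal : ∀ t : ℝ, 0 < t → ∃ e : {j : ℕ // lam j = t} → H, Orthonormal ℝ e ∧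
      ∀ j, e j ∈ Module.End.eigenspace (T : H →ₗ[ℝ] H) t := by
    intro t ht
    have hfin := h.finite t ht
    have : Fintype {j : ℕ // lam j = t} := hfin.fintype
    by_cases hE : FiniteDimensional ℝ (Module.End.eigenspace (T : H →ₗ[ℝ] H) t)
    · have hcard : Module.finrank ℝ (Module.End.eigenspace (T : H →ₗ[ℝ] H) t) =
          Fintype.card {j : ℕ // lam j = t} := by
        rw [h.multiplicity t ht, ← Nat.card_eq_fintype_card]
        rfl
      let b := (stdOrthonormalBasis ℝ (Module.End.eigenspace (T : H →ₗ[ℝ] H) t)).reindex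
        (Fintype.equivOfCardEq (by simpa using hcard) :
          Fin _ ≃ {j : ℕ // lam j = t})
      exact ⟨fun j => b j, b.orthonormal.comp_linearIsometry (Submodule.subtypeₗᵢ _),
        fun j => (b j).2⟩
    · -- an infinite-dimensional eigenspace has `finrank` zero, so no index is attached to `t`
      have h0 : {j : ℕ | lam j = t}.ncard = 0 := by
        rw [← h.multiplicity t ht]
        exact Module.finrank_of_infinite_dimensional hE
      have hemp : IsEmpty {j : ℕ // lam j = t} := by
        rw [Set.ncard_eq_zero hfin] at h0
        exact ⟨fun j => by have : j.1 ∈ {j : ℕ | lam j = t} := j.2; simp [h0] at this⟩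
      exact ⟨fun j => hemp.elim j, ⟨fun j => hemp.elim j, fun j => hemp.elim j⟩,
        fun j => hemp.elim j⟩
  choose! e he heT using hlocal
  refine ⟨fun j => e (lam j) ⟨j, rfl⟩, ⟨fun j => (he _ (h.pos j)).1 _, fun i j hij => ?_⟩,
    fun j => ?_⟩
  · -- if `lam i = lam j`, generalising over `t = lam j` puts both vectors in the same basis
    have aux : ∀ t, lam i = t → ∀ k : {j : ℕ // lam j = t}, k.1 = j →
        ⟪e (lam i) ⟨i, rfl⟩, e t k⟫_ℝ = 0 := by
      rintro t rfl k hk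
      refine (he _ (h.pos i)).2 fun hik => hij ?_
      rw [← hk, ← hik]
    by_cases hl : lam i = lam j
    · exact aux _ hl ⟨j, rfl⟩ rfl
    · exact hsymm.orthogonalFamily_eigenspaces hl ⟨_, heT _ (h.pos i) ⟨i, rfl⟩⟩
        ⟨_, heT _ (h.pos j) ⟨j, rfl⟩⟩
  · exact Module.End.mem_eigenspace_iff.1 (heT _ (h.pos j) ⟨j, rfl⟩)

lemma charFun_map_adjoint {E F : Type*} [NormedAddCommGroup E] [InnerProductSpace ℝ E]
    [CompleteSpace E] [MeasurableSpace E] [BorelSpace E] [NormedAddCommGroup F]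
    [InnerProductSpace ℝ F] [CompleteSpace F] [MeasurableSpace F] [BorelSpace F]
    [SecondCountableTopology F] (μ : Measure E) (J : F →L[ℝ] E) (y : F) :
    charFun (μ.map (ContinuousLinearMap.adjoint J)) y = charFun μ (J y) := by
  rw [charFun_apply, charFun_apply, integral_map
    (ContinuousLinearMap.adjoint J).continuous.measurable.aemeasurable]
  · simp only [ContinuousLinearMap.adjoint_inner_left]
  · exact (by fun_prop : Continuous fun x : F =>
      Complex.exp ((⟪x, y⟫_ℝ : ℂ) * Complex.I)).aestronglyMeasurable

/-- Orthogonal projection onto the span of `N` leading eigenvectors does not increase norms, so a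
ball of `H` has at most the mass of the ball of `ℝ^N` under the projected law. -/
lemma IsStableLaw.measureReal_closedBall_le [CompleteSpace H] [MeasurableSpace H] [BorelSpace H]
    {T : H →L[ℝ] H} {lam : ℕ → ℝ} {ν : Measure H} {α : ℝ} (hα : 0 < α)
    (hT : T.IsPositive) (hlam : IsEigenvalueSequence T lam) (hν : IsStableLaw ν α T)
    {N : ℕ} (hN : 0 < N) {r : ℝ} (hr : 0 < r) :
    ν.real (Metric.closedBall 0 r) ≤ r ^ N * (∏ j : Fin N, √(lam j))⁻¹ *
      (((2 * Real.pi) ^ N)⁻¹ * volume.real (Metric.ball (0 : EuclideanSpace ℝ (Fin N)) 1) ^ 2 *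
        (2 : ℝ) ^ (N / α) * Real.Gamma (N / α + 1)) := by
  obtain ⟨e, he, hTe⟩ := hlam.exists_orthonormal hT
  have := hν.isProbabilityMeasure
  have heN : Orthonormal ℝ (fun j : Fin N => e j) := he.comp _ Fin.val_injective
  let J₀ : EuclideanSpace ℝ (Fin N) →ₗ[ℝ] H :=
    { toFun := fun y => ∑ j, y j • e j
      map_add' := fun x y => by simp [add_smul, Finset.sum_add_distrib]
      map_smul' := fun c y => by simp [mul_smul, Finset.smul_sum] }
  have hJ₀ : ∀ y, J₀ y = ∑ j, y j • e j := fun y => rfl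
  have hnorm : ∀ y, ‖J₀ y‖ = ‖y‖ := by
    intro y
    rw [← sq_eq_sq₀ (norm_nonneg _) (norm_nonneg _), ← real_inner_self_eq_norm_sq, hJ₀,
      heN.inner_sum, EuclideanSpace.norm_sq_eq]
    simp [pow_two]
  let J : EuclideanSpace ℝ (Fin N) →L[ℝ] H :=
    (⟨J₀, hnorm⟩ : EuclideanSpace ℝ (Fin N) →ₗᵢ[ℝ] H).toContinuousLinearMap
  have hJ : ∀ y, J y = ∑ j, y j • e j := fun y => rfl
  set P := ContinuousLinearMap.adjoint J with hP
  have hPnorm : ∀ x, ‖P x‖ ≤ ‖x‖ := by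
    intro x
    have h1 : ‖P‖ ≤ 1 := by
      rw [hP, LinearIsometryEquiv.norm_map]
      exact LinearIsometry.norm_toContinuousLinearMap_le _
    exact (P.le_opNorm x).trans (mul_le_of_le_one_left (norm_nonneg _) h1)
  have hPm : Measurable P := P.continuous.measurable
  have : IsProbabilityMeasure (ν.map P) := Measure.isProbabilityMeasure_map hPm.aemeasurable
  have hchar : ∀ y, charFun (ν.map P) y =
      ((Real.exp (-(1 / 2) * (∑ j : Fin N, lam j * y j ^ 2) ^ (α / 2)) : ℝ) : ℂ) := by
    intro y
    rw [hP, charFun_map_adjoint, hν.charFun_eq]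
    congr 5
    rw [hJ, map_sum]
    have : ∑ j : Fin N, T (y j • e j) = ∑ j : Fin N, (y j * lam j) • e j := by
      refine Finset.sum_congr rfl fun j _ => ?_
      rw [map_smul, hTe, smul_smul]
    rw [this, heN.inner_sum]
    refine Finset.sum_congr rfl fun j _ => ?_
    simp
    ring
  refine le_trans ?_ (measureReal_closedBall_le_of_stable hN hα (fun j : Fin N => lam j)
    (fun j => hlam.pos j) (ν.map P) hchar hr)
  rw [map_measureReal_apply hPm Metric.isClosed_closedBall.measurableSet]
  refine measureReal_mono fun x hx => ?_
  simp only [mem_preimage, mem_closedBall_zero_iff] at hx ⊢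
  exact (hPnorm x).trans hx

end Projection

/-! ### Bounds of Stirling type for the Gamma function -/

section Gamma

lemma log_factorial_le {n : ℕ} (hn : n ≠ 0) :
    Real.log (n.factorial : ℝ) ≤ n * Real.log n - n + Real.log n / 2 + 1 := by
  obtain ⟨m, rfl⟩ := Nat.exists_eq_succ_of_ne_zero hn
  have h := Stirling.log_stirlingSeq'_antitone (Nat.zero_le m)
  have hn0 : ((m + 1 : ℕ) : ℝ) ≠ 0 := by positivity
  simp only [Function.comp, Nat.succ_eq_add_one, zero_add] at h
  rw [Stirling.log_stirlingSeq_formula, Stirling.stirlingSeq_one,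
    Real.log_div (Real.exp_pos 1).ne' (by positivity), Real.log_exp,
    Real.log_sqrt (by norm_num), Real.log_mul (by norm_num) hn0,
    Real.log_div hn0 (Real.exp_pos 1).ne', Real.log_exp] at h
  simp only [Nat.succ_eq_add_one]
  linarith

lemma log_Gamma_add_le {x s : ℝ} (hx : 0 < x) (hs0 : 0 ≤ s) (hs1 : s ≤ 1) :
    Real.log (Real.Gamma (x + s)) ≤ Real.log (Real.Gamma x) + s * Real.log x := by
  have h := Real.convexOn_log_Gamma.2 (x := x) (y := x + 1) hx (by simp; linarith)
    (sub_nonneg.2 hs1) hs0 (by ring)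
  simp only [Function.comp, smul_eq_mul] at h
  rw [Real.Gamma_add_one hx.ne', Real.log_mul hx.ne' (Real.Gamma_pos_of_pos hx).ne'] at h
  have e : (1 - s) * x + s * (x + 1) = x + s := by ring
  rw [e] at h
  linarith

/-- An upper bound of Stirling type for the Gamma function, off the integers by log-convexity. -/
lemma log_Gamma_add_one_le {x : ℝ} (hx : 1 / 2 ≤ x) :
    Real.log (Real.Gamma (x + 1)) ≤ (x + 1 / 2) * Real.log x - x + 3 := by
  have hx0 : 0 < x := by linarith
  rcases le_total x 1 with h1 | h1
  · have h := log_Gamma_add_le one_pos hx0.le h1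
    rw [add_comm, Real.Gamma_one, Real.log_one] at h
    have h2 := Real.one_sub_inv_le_log_of_pos hx0
    have h3 : x⁻¹ ≤ 2 := by
      rw [inv_le_comm₀ hx0 two_pos]; linarith
    nlinarith
  · set n := ⌊x⌋₊ with hn
    have hn1 : 1 ≤ n := Nat.le_floor (by simpa using h1)
    have hn1' : (1 : ℝ) ≤ n := by exact_mod_cast hn1
    have hnx : (n : ℝ) ≤ x := Nat.floor_le hx0.le
    have hxn : x < n + 1 := Nat.lt_floor_add_one x
    have h := log_Gamma_add_le (x := (n : ℝ) + 1) (s := x - n) (by positivity)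
      (by linarith) (by linarith)
    rw [Real.Gamma_nat_eq_factorial] at h
    have e : (n : ℝ) + 1 + (x - n) = x + 1 := by ring
    rw [e] at h
    have hf := log_factorial_le (n := n) (by omega)
    have hl1 : Real.log n ≤ Real.log x := Real.log_le_log (by linarith) hnx
    have hl2 : Real.log (n + 1) ≤ Real.log x + 1 := by
      have h4 : Real.log (n + 1) ≤ Real.log (2 * x) := Real.log_le_log (by linarith) (by linarith)
      rw [Real.log_mul two_ne_zero hx0.ne'] at h4
      have := Real.log_two_lt_d9
      linarith
    have hl0 : 0 ≤ Real.log x := Real.log_nonneg h1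
    have h5 : (x - n) * Real.log (n + 1) ≤ (x - n) * (Real.log x + 1) := by
      gcongr
    have h6 : (n : ℝ) * Real.log n ≤ n * Real.log x := by gcongr
    linarith

/-- A lower bound for `Γ(N/2+1)²`: log-convexity replaces one factor by `√(N/2) Γ(N/2+1/2)`, and
the duplication formula turns the product into `N!`. -/
lemma le_two_mul_log_Gamma_half_add_one {N : ℕ} (hN : 0 < N) :
    N * Real.log N - N + Real.log N - N * Real.log 2 + Real.log Real.pi ≤
      2 * Real.log (Real.Gamma (N / 2 + 1)) := by
  have hN0 : (0 : ℝ) < N := by exact_mod_cast hN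
  have hG1 := Real.Gamma_pos_of_pos (s := (N : ℝ) / 2 + 1 / 2) (by positivity)
  have hG2 := Real.Gamma_pos_of_pos (s := (N : ℝ) / 2 + 1) (by positivity)
  have hG3 := Real.Gamma_pos_of_pos (s := (N : ℝ) / 2) (by positivity)
  have hd := congrArg Real.log (Real.Gamma_mul_Gamma_add_half ((N : ℝ) / 2 + 1 / 2))
  have e1 : (N : ℝ) / 2 + 1 / 2 + 1 / 2 = N / 2 + 1 := by ring
  have e2 : 2 * ((N : ℝ) / 2 + 1 / 2) = N + 1 := by ring
  have e3 : 1 - ((N : ℝ) + 1) = -N := by ring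
  rw [e1, e2, e3, Real.Gamma_nat_eq_factorial, Real.log_mul hG1.ne' hG2.ne',
    Real.log_mul (by positivity) (by positivity), Real.log_mul (by positivity) (by positivity),
    Real.log_rpow two_pos, Real.log_sqrt Real.pi_pos.le] at hd
  have hc := log_Gamma_add_le (x := (N : ℝ) / 2) (s := 1 / 2) (by positivity) (by norm_num)
    (by norm_num)
  have hrec : Real.log (Real.Gamma (N / 2 + 1)) =
      Real.log (N / 2) + Real.log (Real.Gamma (N / 2)) := by
    rw [Real.Gamma_add_one (by positivity), Real.log_mul (by positivity) hG3.ne']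
  have hst := Stirling.le_log_factorial_stirling hN.ne'
  rw [Real.log_mul two_ne_zero Real.pi_ne_zero] at hst
  rw [Real.log_div hN0.ne' two_ne_zero] at hc hrec
  linarith

/-- The dimensional constant in the small ball estimate on `ℝ^N`, evaluated by Stirling's
formula. -/
lemma dimensional_constant_le {α : ℝ} (hα0 : 0 < α) (hα2 : α ≤ 2) {N : ℕ} (hN : 0 < N) :
    ((2 * Real.pi) ^ N)⁻¹ * volume.real (Metric.ball (0 : EuclideanSpace ℝ (Fin N)) 1) ^ 2 *
        (2 : ℝ) ^ (N / α) * Real.Gamma (N / α + 1) ≤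
      Real.exp (N * (1 / α * Real.log (2 / α)) + (1 / α - 1) * (N * Real.log N - N)
        - Real.log N / 2 - Real.log α / 2 + 3) := by
  have hN0 : (0 : ℝ) < N := by exact_mod_cast hN
  have hN1 : (1 : ℝ) ≤ N := by exact_mod_cast hN
  have : Nonempty (Fin N) := ⟨⟨0, hN⟩⟩
  have hG := Real.Gamma_pos_of_pos (s := (N : ℝ) / 2 + 1) (by positivity)
  have hG' := Real.Gamma_pos_of_pos (s := (N : ℝ) / α + 1) (by positivity)
  have hπ := Real.pi_pos
  have hV : volume.real (Metric.ball (0 : EuclideanSpace ℝ (Fin N)) 1) =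
      √Real.pi ^ N / Real.Gamma (N / 2 + 1) := by
    rw [measureReal_def, EuclideanSpace.volume_ball]
    simp only [Fintype.card_fin, ENNReal.ofReal_one, one_pow, one_mul]
    rw [ENNReal.toReal_ofReal (by positivity)]
  rw [hV, ← Real.log_le_iff_le_exp (by positivity), Real.log_mul (by positivity) hG'.ne',
    Real.log_mul (by positivity) (by positivity), Real.log_mul (by positivity) (by positivity),
    Real.log_inv, Real.log_pow, Real.log_pow, Real.log_div (by positivity) hG.ne', Real.log_pow,
    Real.log_sqrt hπ.le, Real.log_mul two_ne_zero hπ.ne', Real.log_rpow two_pos]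
  have hup := log_Gamma_add_one_le (x := (N : ℝ) / α) (by
    rw [div_le_div_iff₀ two_pos hα0]; linarith)
  have hlow := le_two_mul_log_Gamma_half_add_one hN
  have hlπ : 0 ≤ Real.log Real.pi := Real.log_nonneg (by linarith [Real.pi_gt_three])
  rw [Real.log_div hN0.ne' hα0.ne'] at hup
  rw [Real.log_div two_ne_zero hα0.ne']
  push_cast
  have e : (N : ℝ) / α = N * (1 / α) := by ring
  rw [e] at hup ⊢
  generalize 1 / α = β at *
  linarith

end Gamma

/-! ### Sums and integrals of decreasing functions -/

section SumIntegral

lemma integral_add_le_sum_of_antitoneOn {g : ℝ → ℝ} (hg : AntitoneOn g (Ici 1)) (n : ℕ) :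
    (∫ x in (1 : ℝ)..(n + 1 : ℕ), g x) + g (n + 1 : ℕ) ≤
      ∑ j ∈ Finset.range (n + 1), g (j + 1) := by
  have h := AntitoneOn.integral_le_sum (f := g) (x₀ := 1) (a := n)
    (hg.mono fun x hx => hx.1)
  rw [Finset.sum_range_succ]
  have e : ((n + 1 : ℕ) : ℝ) = 1 + n := by push_cast; ring
  rw [e, add_comm (n : ℝ) 1]
  simp only [add_comm _ (1 : ℝ)]
  linarith

lemma integral_le_half_add_of_convexOn {g : ℝ → ℝ} {a : ℝ} (hg : ConvexOn ℝ (Icc a (a + 1)) g)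
    (hi : IntervalIntegrable g volume a (a + 1)) :
    ∫ x in a..(a + 1), g x ≤ (g a + g (a + 1)) / 2 := by
  have h : ∫ x in a..(a + 1), g x ≤ ∫ x in a..(a + 1), (g a + (x - a) * (g (a + 1) - g a)) := by
    refine intervalIntegral.integral_mono_on (by linarith) hi
      (Continuous.intervalIntegrable (by fun_prop) _ _) fun x hx => ?_
    have hc := hg.2 (left_mem_Icc.2 (by linarith : a ≤ a + 1))
      (right_mem_Icc.2 (by linarith : a ≤ a + 1)) 
      (sub_nonneg.2 hx.2) (sub_nonneg.2 hx.1) (by ring)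
    simp only [smul_eq_mul] at hc
    have e : (a + 1 - x) * a + (x - a) * (a + 1) = x := by ring
    rw [e] at hc
    linarith
  refine h.trans_eq ?_
  rw [intervalIntegral.integral_add (by simp) (Continuous.intervalIntegrable (by fun_prop) _ _),
    intervalIntegral.integral_mul_const,
    intervalIntegral.integral_sub (by simp) (by simp), integral_id]
  simp
  ring

/-- The trapezoidal rule overestimates the integral of a convex function. -/
lemma integral_add_le_sum_of_convexOn {g : ℝ → ℝ} (hg : AntitoneOn g (Ici 1))
    (hc : ConvexOn ℝ (Ici 1) g) (n : ℕ) :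
    (∫ x in (1 : ℝ)..(n + 1 : ℕ), g x) + g 1 / 2 + g (n + 1 : ℕ) / 2 ≤
      ∑ j ∈ Finset.range (n + 1), g (j + 1) := by
  have hii : ∀ a b : ℝ, 1 ≤ a → 1 ≤ b → IntervalIntegrable g volume a b := by
    intro a b ha hb
    refine (hg.mono fun x hx => ?_).intervalIntegrable
    exact (le_min ha hb).trans hx.1
  induction n with
  | zero => simp
  | succ n ih =>
    rw [Finset.sum_range_succ]
    have h1 : (1 : ℝ) ≤ (n + 1 : ℕ) := by push_cast; linarith [n.cast_nonneg (α := ℝ)]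
    have e : ((n + 1 + 1 : ℕ) : ℝ) = (n + 1 : ℕ) + 1 := by push_cast; ring
    have ha := integral_le_half_add_of_convexOn (a := (n + 1 : ℕ))
      (hc.subset (fun x hx => h1.trans hx.1) (convex_Icc _ _))
      (hii _ _ h1 (by linarith))
    rw [e, ← intervalIntegral.integral_add_adjacent_intervals (hii 1 _ le_rfl h1)
      (hii _ _ h1 (by linarith))]
    linarith

end SumIntegral

/-! ### The functions `κ` and `L` -/

section Ell

variable {α : ℝ} {σ : ℝ → ℝ}

lemma mul_deriv_kappa_div (hα : 0 < α) {x : ℝ} (hx : 0 < x) (hσ : DifferentiableAt ℝ σ x)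
    (hpos : 0 < σ x) :
    x * deriv (kappa α σ) x / kappa α σ x = (1 / α - 1) + -(x * (deriv σ x / σ x)) := by
  have h := ((Real.hasDerivAt_rpow_const (p := (1 - α) / α) (Or.inl hx.ne')).const_mul
    ((2 / α) ^ (1 / α))).mul (hσ.hasDerivAt.inv hpos.ne')
  have h' : deriv (kappa α σ) x = _ := h.deriv
  rw [h', kappa, Real.rpow_sub_one hx.ne']
  have hxp : 0 < x ^ ((1 - α) / α) := Real.rpow_pos_of_pos hx _
  have hK : 0 < (2 / α) ^ (1 / α) := by positivity
  generalize x ^ ((1 - α) / α) = X at *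
  generalize (2 / α) ^ (1 / α) = K at *
  simp only [Pi.inv_apply]
  field_simp

/-- Integration by parts in the definition of `L`. Since `σ` is decreasing, its derivative is
integrable, although no continuity of the derivative is assumed. -/
lemma ell_eq (hα : 0 < α) (hσd : DifferentiableOn ℝ σ (Ici 1)) (hσa : AntitoneOn σ (Ici 1))
    (hσp : ∀ x : ℝ, 1 ≤ x → 0 < σ x) {y : ℝ} (hy : 1 ≤ y) :
    ell α σ y = (1 / α - 1) * (y - 1) - y * Real.log (σ y) + Real.log (σ 1)
      + ∫ x in (1 : ℝ)..y, Real.log (σ x) := by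
  set g : ℝ → ℝ := fun x => Real.log (σ x) with hg
  have hgc : ContinuousOn g (Ici 1) :=
    hσd.continuousOn.log fun x hx => (hσp x hx).ne'
  have hgc' : ContinuousOn g (Icc 1 y) := hgc.mono Icc_subset_Ici_self
  have hda : ∀ x, 1 < x → DifferentiableAt ℝ σ x := fun x hx =>
    (hσd x hx.le).differentiableAt (Ici_mem_nhds hx)
  have hneg : ∀ x, 1 < x → deriv σ x ≤ 0 := by
    intro x hx
    rw [← derivWithin_of_mem_nhds (Ici_mem_nhds hx)]
    exact hσa.derivWithin_nonpos
  let G : ℝ → ℝ := fun x => -(x * g x) + ∫ t in (1 : ℝ)..x, g t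
  have hGd : ∀ x ∈ Ioo 1 y, HasDerivAt G (-(x * (deriv σ x / σ x))) x := by
    intro x hx
    have h1 : HasDerivAt g (deriv σ x / σ x) x :=
      (hda x hx.1).hasDerivAt.log (hσp x hx.1.le).ne'
    have h2 : HasDerivAt (fun x => ∫ t in (1 : ℝ)..x, g t) (g x) x := by
      refine intervalIntegral.integral_hasDerivAt_right
        ((hgc'.mono (by rw [uIcc_of_le hx.1.le]; exact Icc_subset_Icc_right hx.2.le)
          ).intervalIntegrable) ?_ h1.continuousAt
      exact (hgc.mono Ioi_subset_Ici_self).stronglyMeasurableAtFilter isOpen_Ioi x hx.1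
    have h3 := (((hasDerivAt_id x).mul h1).neg).add h2
    refine h3.congr_deriv ?_
    simp only [id]
    ring
  have hGc : ContinuousOn G (Icc 1 y) := by
    refine (continuousOn_id.mul hgc').neg.add ?_
    rw [← uIcc_of_le hy] at hgc' ⊢
    exact intervalIntegral.continuousOn_primitive_interval hgc'.integrableOn_uIcc
  have hGi : IntervalIntegrable (fun x => -(x * (deriv σ x / σ x))) volume 1 y := by
    refine intervalIntegral.intervalIntegrable_deriv_of_nonneg (g := G)
      (by rwa [uIcc_of_le hy]) ?_ ?_ <;> rw [min_eq_left hy, max_eq_right hy]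
    · exact hGd
    · intro x hx
      have := div_nonpos_of_nonpos_of_nonneg (hneg x hx.1) (hσp x hx.1.le).le
      have hx0 : 0 < x := by linarith [hx.1]
      nlinarith
  have hFTC := intervalIntegral.integral_eq_sub_of_hasDerivAt_of_le hy hGc hGd hGi
  have hcongr : ell α σ y =
      ∫ x in (1 : ℝ)..y, ((1 / α - 1) + -(x * (deriv σ x / σ x))) := by
    refine intervalIntegral.integral_congr_ae (Filter.Eventually.of_forall fun x hx => ?_)
    rw [uIoc_of_le hy] at hx
    exact mul_deriv_kappa_div hα (by linarith [hx.1]) (hda x hx.1) (hσp x hx.1.le)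
  rw [hcongr, intervalIntegral.integral_add (by simp) hGi, hFTC]
  simp [G, hg]
  ring

lemma log_add_log_kappa_nonpos (hα : 0 < α) {ε x : ℝ} (hε : 0 < ε) (hx : 0 < x)
    (hσ : 0 < σ x) (h : ε * kappa α σ x ≤ 1) :
    Real.log ε + 1 / α * Real.log (2 / α) + (1 / α - 1) * Real.log x - Real.log (σ x) ≤ 0 := by
  have hκ : 0 < kappa α σ x := by
    unfold kappa
    have := Real.rpow_pos_of_pos hx ((1 - α) / α)
    positivity
  have hl := Real.log_nonpos (by positivity) h
  have hxp := Real.rpow_pos_of_pos hx ((1 - α) / α)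
  rw [Real.log_mul hε.ne' hκ.ne', kappa, Real.log_mul (by positivity) (by positivity),
    Real.log_mul (by positivity) hxp.ne', Real.log_rpow (by positivity), Real.log_rpow hx,
    Real.log_inv] at hl
  have e : (1 - α) / α = 1 / α - 1 := by field_simp
  rw [e] at hl
  linarith

end Ell

/-! ### The small ball estimate -/

/-- The small ball estimate in dimension `N`, with the eigenvalues replaced by their lower bounds
and the dimensional constant by its Stirling approximation. -/
lemma IsStableLaw.measureReal_closedBall_le_exp {H : Type u} [NormedAddCommGroup H]
    [InnerProductSpace ℝ H] [CompleteSpace H] [MeasurableSpace H] [BorelSpace H]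
    {T : H →L[ℝ] H} {lam : ℕ → ℝ} {ν : Measure H} {σ : ℝ → ℝ} {α : ℝ} (hα0 : 0 < α) (hα2 : α ≤ 2)
    (hT : T.IsPositive) (hlam : IsEigenvalueSequence T lam) (hν : IsStableLaw ν α T)
    (hσp : ∀ x : ℝ, 1 ≤ x → 0 < σ x)
    (hσl : ∀ j : ℕ, σ ((j : ℝ) + 1) ≤ lam j ^ (1 / 2 : ℝ))
    {N : ℕ} (hN : 0 < N) {ε : ℝ} (hε : 0 < ε) :
    ν.real (Metric.closedBall 0 ε) ≤
      Real.exp (N * Real.log ε - (∑ j ∈ Finset.range N, Real.log (σ (j + 1))) +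
        (N * (1 / α * Real.log (2 / α)) + (1 / α - 1) * (N * Real.log N - N)
        - Real.log N / 2 - Real.log α / 2 + 3)) := by
  refine (hν.measureReal_closedBall_le hα0 hT hlam hN hε).trans ?_
  have hs : ∀ j : ℕ, 0 < σ (j + 1) := fun j => hσp _ (by linarith [j.cast_nonneg (α := ℝ)])
  have hprod : (∏ j : Fin N, √(lam j))⁻¹ ≤
      Real.exp (-∑ j ∈ Finset.range N, Real.log (σ (j + 1))) := by
    rw [Real.exp_neg, Real.exp_sum, Finset.prod_range]
    refine inv_anti₀ (Finset.prod_pos fun j _ => Real.exp_pos _)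
      (Finset.prod_le_prod (fun j _ => (Real.exp_pos _).le) fun j _ => ?_)
    rw [Real.exp_log (hs j), Real.sqrt_eq_rpow]
    exact hσl j
  rw [Real.exp_add, sub_eq_add_neg, Real.exp_add]
  have hεN : ε ^ N = Real.exp (N * Real.log ε) := by
    rw [Real.exp_nat_mul, Real.exp_log hε]
  rw [← hεN]
  have hG := Real.Gamma_pos_of_pos (s := (N : ℝ) / α + 1) (by positivity)
  gcongr
  exact dimensional_constant_le hα0 hα2 hN

end SmallBall

theorem proposition2 (α : ℝ) (hα0 : 0 < α) (hα2 : α ≤ 2) (lam1 : ℝ) (hlam1 : 0 < lam1) :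
    ∃ C : ℝ, 0 < C ∧
      ∀ (H : Type u) [NormedAddCommGroup H] [InnerProductSpace ℝ H] [CompleteSpace H]
        [TopologicalSpace.SeparableSpace H] [MeasurableSpace H] [BorelSpace H]
        (T : H →L[ℝ] H) (lam : ℕ → ℝ) (ν : Measure H) (σ : ℝ → ℝ) (ζ : ℝ → ℕ),
        SmallBall.IsPositiveTraceClass T →
        SmallBall.IsEigenvalueSequence T lam →
        lam 0 = lam1 →
        SmallBall.IsStableLaw ν α T →
        DifferentiableOn ℝ σ (Ici 1) →
        AntitoneOn σ (Ici 1) →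
        (∀ x : ℝ, 1 ≤ x → 0 < σ x) →
        (∀ j : ℕ, σ ((j : ℝ) + 1) ≤ lam j ^ (1 / 2 : ℝ)) →
        (∀ ε : ℝ, 0 < ε → ε < (SmallBall.kappa α σ 1)⁻¹ →
          1 ≤ ζ ε ∧ ε * SmallBall.kappa α σ (ζ ε) ≤ 1) →
        (∀ ε : ℝ, 0 < ε → ε < (SmallBall.kappa α σ 1)⁻¹ →
          ν.real (Metric.closedBall 0 ε) ≤
            C * Real.exp (-SmallBall.ell α σ (ζ ε)
              - (2 - α) / (2 * α) * Real.log (ζ ε) - Real.log ε)) ∧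
        (ConvexOn ℝ (Ici 1) (fun x => Real.log (σ x)) →
          ∀ ε : ℝ, 0 < ε → ε < (SmallBall.kappa α σ 1)⁻¹ →
            ν.real (Metric.closedBall 0 ε) ≤
              C * Real.exp (-SmallBall.ell α σ (ζ ε)
                - 1 / (2 * α) * Real.log (ε ^ α * (ζ ε : ℝ)))) := by
  set β := 1 / α with hβ
  set K₁ := 3 - Real.log α / 2 - (β - 1) - β * Real.log (2 / α) + Real.log lam1 / 2 with hK₁
  set K₂ := 3 - Real.log α / 2 - (β - 1) - β * Real.log (2 / α) / 2 + Real.log lam1 / 4 with hK₂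
  refine ⟨Real.exp K₁ + Real.exp K₂, by positivity, ?_⟩
  intro H _ _ _ _ _ _ T lam ν σ ζ hT hlam hlam0 hν hσd hσa hσp hσl hζ
  have hga : AntitoneOn (fun x => Real.log (σ x)) (Ici 1) := fun x hx y hy hxy =>
    Real.log_le_log (hσp y hy) (hσa hx hy hxy)
  have hσ1 : Real.log (σ 1) ≤ Real.log lam1 / 2 := by
    have h := hσl 0
    rw [hlam0] at h
    simp only [Nat.cast_zero, zero_add] at h
    have h' := Real.log_le_log (hσp 1 le_rfl) h
    rw [Real.log_rpow hlam1] at h'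
    linarith
  -- both estimates compare exponents of the same `N`-dimensional bound with `N = ζ ε`
  have hmain : ∀ ε : ℝ, 0 < ε → ε < (SmallBall.kappa α σ 1)⁻¹ → ∃ n : ℕ, ζ ε = n + 1 ∧
      Real.log ε + β * Real.log (2 / α) + (β - 1) * Real.log (n + 1 : ℕ)
        - Real.log (σ (n + 1 : ℕ)) ≤ 0 := by
    intro ε hε hε1
    obtain ⟨h1, h2⟩ := hζ ε hε hε1
    obtain ⟨n, hn⟩ : ∃ n, ζ ε = n + 1 := ⟨ζ ε - 1, by omega⟩
    rw [hn] at h2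
    exact ⟨n, hn, SmallBall.log_add_log_kappa_nonpos hα0 hε (by positivity)
      (hσp _ (by push_cast; linarith [n.cast_nonneg (α := ℝ)])) h2⟩
  refine ⟨fun ε hε hε1 => ?_, fun hconv ε hε hε1 => ?_⟩
  · obtain ⟨n, hn, hk⟩ := hmain ε hε hε1
    have hN1 : (1 : ℝ) ≤ (n + 1 : ℕ) := by push_cast; linarith [n.cast_nonneg (α := ℝ)]
    have hb := hν.measureReal_closedBall_le_exp hα0 hα2 hT.1 hlam hσp hσl
      (Nat.succ_pos n) hε
    have hsum := SmallBall.integral_add_le_sum_of_antitoneOn hga n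
    have hell := SmallBall.ell_eq hα0 hσd hσa hσp hN1
    rw [hn]
    refine hb.trans ((?_ : _ ≤ Real.exp K₁ * _).trans (by gcongr; linarith [Real.exp_pos K₂]))
    rw [← Real.exp_add, Real.exp_le_exp, hell]
    have e : (2 - α) / (2 * α) = β - 1 / 2 := by rw [hβ]; field_simp
    rw [e, hK₁, ← hβ]
    have hk' := mul_nonpos_of_nonneg_of_nonpos (by linarith : (0 : ℝ) ≤ (n + 1 : ℕ) + 1) hk
    linarith
  · obtain ⟨n, hn, hk⟩ := hmain ε hε hε1
    have hN1 : (1 : ℝ) ≤ (n + 1 : ℕ) := by push_cast; linarith [n.cast_nonneg (α := ℝ)]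
    have hb := hν.measureReal_closedBall_le_exp hα0 hα2 hT.1 hlam hσp hσl
      (Nat.succ_pos n) hε
    have hsum := SmallBall.integral_add_le_sum_of_convexOn hga hconv n
    have hell := SmallBall.ell_eq hα0 hσd hσa hσp hN1
    rw [hn]
    refine hb.trans ((?_ : _ ≤ Real.exp K₂ * _).trans (by gcongr; linarith [Real.exp_pos K₁]))
    have e : 1 / (2 * α) * Real.log (ε ^ α * (n + 1 : ℕ)) =
        Real.log ε / 2 + β / 2 * Real.log (n + 1 : ℕ) := by
      rw [Real.log_mul (by positivity) (by positivity), Real.log_rpow hε, hβ]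
      field_simp
    rw [← Real.exp_add, Real.exp_le_exp, hell, e, hK₂, ← hβ]
    have hk' := mul_nonpos_of_nonneg_of_nonpos
      (by linarith : (0 : ℝ) ≤ (n + 1 : ℕ) + 1 / 2) hk
    linarith
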